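/- A bipartite max-min LP consists of a finite bipartite graph $\mathcal G=(V\cup I\cup K,E)$, with $V,I,K$ disjoint, in which every edge joins an agent $v\in V$ to a constraint $i\in I$ or to an objective $k\in K$ and every agent is adjacent to exactly one constraint and exactly one objective, together with coefficients $a_{iv}\ge 0$ on the edges $\{i,v\}$ and $c_{kv}\ge 0$ on the edges $\{k,v\}$. Write $V_i$ and $V_k$ for the sets of agents adjacent to $i\in I$ and to $k\in K$. A vector $x\in\mathbb R^V$ is feasible if $x_v\ge 0$ for all $v\in V$ and $\sum_{v\in V_i}a_{iv}x_v\le 1$ for all $i\in I$, and the optimum is $$\omega^*=\sup_{x\text{ feasible}}\ \min_{k\in K}\ \sum_{v\in V_k}c_{kv}x_v .$$ A local algorithm that uses only port numbering is a deterministic synchronous message-passing algorithm, the same for all nodes of $\mathcal G$, that runs for a number of rounds $r$ independent of the input. The nodes have no identifiers; each node has an arbitrary ordering of its incident edges (its ports) and initially knows only whether it is an agent, a constraint or an objective, its degree and, if it is an agent, for each of its ports whether the port leads to the constraint or to the objective and the coefficient of that edge. In each round every node sends a message through each of its ports, receives one message from each port and updates its state; after $r$ rounds each agent $v$ outputs a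 number $x_v$. Theorem. For all integers $\Delta_I\ge 2$ and $\Delta_K\ge 2$ and every real $\epsilon>0$ there is a local algorithm that uses only port numbering and such that the following holds for every bipartite max-min LP with $|V_i|\le\Delta_I$ for all $i\in I$ and $|V_k|\le\Delta_K$ for all $k\in K$, and for every port numbering of its graph. The output $x$ is feasible. Moreover, if each agent $v$ with constraint $i$ and objective $k$ satisfies $a_{iv}>0$ whenever $c_{kv}>0$ (equivalently, if each single objective function is bounded above on the set of feasible solutions), then the algorithm has approximation ratio $\Delta_I(1-1/\Delta_K)+\epsilon$, that is, $$\sum_{v\in V_k}c_{kv}x_v\ \ge\ \frac{\omega^*}{\Delta_I(1-1/\Delta_K)+\epsilon}\qquad\text{for all }k\in K.$$ -/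

import Mathlib

/-- The vertices of a communication graph: agents, constraints and objectives. -/
inductive Node (V I K : Type*) where
  | agent (v : V)
  | constr (i : I)
  | obj (k : K)

/-- The data of a max-min linear program: a graph on `V ∪ I ∪ K` each of whose edges joins an
agent to a constraint or to an objective, with a nonnegative coefficient on every edge.
The values of `a` and `c` at non-adjacent pairs are never used. -/
structure MaxMinLP (V I K : Type*) where
  graph : SimpleGraph (Node V I K)
  not_adj_agent_agent : ∀ u v : V, ¬ graph.Adj (.agent u) (.agent v)
  not_adj_constr_constr : ∀ i j : I, ¬ graph.Adj (.constr i) (.constr j)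
  not_adj_constr_obj : ∀ (i : I) (k : K), ¬ graph.Adj (.constr i) (.obj k)
  not_adj_obj_obj : ∀ k l : K, ¬ graph.Adj (.obj k) (.obj l)
  a : I → V → ℝ
  c : K → V → ℝ
  a_nonneg : ∀ i v, graph.Adj (.agent v) (.constr i) → 0 ≤ a i v
  c_nonneg : ∀ k v, graph.Adj (.agent v) (.obj k) → 0 ≤ c k v

namespace MaxMinLP

variable {V I K : Type*}

open Classical in
/-- The set `V_i` of agents adjacent to the constraint `i`. -/
noncomputable def constrAgents [Fintype V] (P : MaxMinLP V I K) (i : I) : Finset V :=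
  Finset.univ.filter fun v => P.graph.Adj (.agent v) (.constr i)

open Classical in
/-- The set `V_k` of agents adjacent to the objective `k`. -/
noncomputable def objAgents [Fintype V] (P : MaxMinLP V I K) (k : K) : Finset V :=
  Finset.univ.filter fun v => P.graph.Adj (.agent v) (.obj k)

/-- The bipartite version: every agent is adjacent to exactly one constraint and to exactly one
objective. -/
def IsBipartite (P : MaxMinLP V I K) : Prop :=
  ∀ v : V, (∃! i : I, P.graph.Adj (.agent v) (.constr i)) ∧
    (∃! k : K, P.graph.Adj (.agent v) (.obj k))

/-- The degree bounds `|V_i| ≤ ΔI` and `|V_k| ≤ ΔK`. -/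
def DegreeBounded [Fintype V] (P : MaxMinLP V I K) (ΔI ΔK : ℕ) : Prop :=
  (∀ i, (P.constrAgents i).card ≤ ΔI) ∧ (∀ k, (P.objAgents k).card ≤ ΔK)

/-- The value of the objective `k` at `x`. -/
noncomputable def objective [Fintype V] (P : MaxMinLP V I K) (k : K) (x : V → ℝ) : ℝ :=
  ∑ v ∈ P.objAgents k, P.c k v * x v

def IsFeasible [Fintype V] (P : MaxMinLP V I K) (x : V → ℝ) : Prop :=
  (∀ i, ∑ v ∈ P.constrAgents i, P.a i v * x v ≤ 1) ∧ ∀ v, 0 ≤ x v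

/-- The utility of `x`: the minimum of the objectives (`K` is finite wherever this is used). -/
noncomputable def utility [Fintype V] (P : MaxMinLP V I K) (x : V → ℝ) : ℝ :=
  ⨅ k, P.objective k x

/-- The optimum of the max-min LP. -/
noncomputable def opt [Fintype V] (P : MaxMinLP V I K) : ℝ :=
  sSup (P.utility '' {x | P.IsFeasible x})

/-- An agent that contributes to its objective with a positive coefficient also has a positive
coefficient in its constraint. For a bipartite max-min LP this says exactly that each objective
function is bounded above on the feasible set. -/
def NonDegenerate (P : MaxMinLP V I K) : Prop :=
  ∀ v i k, P.graph.Adj (.agent v) (.constr i) → P.graph.Adj (.agent v) (.obj k) →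
    0 < P.c k v → 0 < P.a i v

/-- A port numbering: every vertex independently orders the edges incident to it, that is, it
lists its neighbours without repetition. The port number of the edge `{s, t}` in `s` is the
position of `t` in `ports s`. -/
structure PortNumbering (P : MaxMinLP V I K) where
  ports : Node V I K → List (Node V I K)
  nodup : ∀ s, (ports s).Nodup
  mem_ports : ∀ s t, t ∈ ports s ↔ P.graph.Adj s t

end MaxMinLP

/-- What a node knows at the start, in the absence of identifiers. An agent knows, for each of its
ports in turn, whether the port leads to a constraint (`Sum.inl`) or to an objective (`Sum.inr`),
and the coefficient on that edge. A constraint or an objective knows only its number of ports. -/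
inductive LocalInput where
  | agent (edges : List (ℝ ⊕ ℝ))
  | constr (degree : ℕ)
  | obj (degree : ℕ)

/-- A deterministic synchronous distributed algorithm in the port-numbering model that stops
after a fixed number of communication rounds (its local horizon). In each round, every node sends
through each of its ports a message that depends on its state and on the port number; it then
updates its state, using the list of the messages received through its ports, in the order of the
ports. -/
structure PortAlgorithm where
  State : Type
  Msg : Type
  horizon : ℕ
  init : LocalInput → State
  send : State → ℕ → Msg
  step : State → List Msg → State
  output : State → ℝ

namespace PortAlgorithm

variable {V I K : Type*} {P : MaxMinLP V I K}

/-- The local input of a node. (The ports of an agent never lead to another agent, so that the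
list below has one entry for each port.) -/
def localInput (N : P.PortNumbering) : Node V I K → LocalInput
  | .agent v => .agent <| (N.ports (.agent v)).filterMap fun t =>
      match t with
      | .agent _ => none
      | .constr i => some (.inl (P.a i v))
      | .obj k => some (.inr (P.c k v))
  | .constr i => .constr (N.ports (.constr i)).length
  | .obj k => .obj (N.ports (.obj k)).length

open Classical in
/-- The state of each node after the given number of rounds. The node `s` receives through the port
that leads to `t` the message that `t` sends through its port that leads to `s`. -/
noncomputable def state (A : PortAlgorithm) (N : P.PortNumbering) : ℕ → Node V I K → A.State
  | 0, s => A.init (localInput N s)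
  | n + 1, s => A.step (state A N n s)
      ((N.ports s).map fun t => A.send (state A N n t) ((N.ports t).idxOf s))

/-- The solution computed by the algorithm: each agent outputs the value of its variable when the
last round is over. -/
noncomputable def run (A : PortAlgorithm) (N : P.PortNumbering) (v : V) : ℝ :=
  A.output (A.state N A.horizon (.agent v))

end PortAlgorithm

/-! Agents with a zero coefficient are set to 0; for the others, the substitution of c_v x_v for x_v
makes every objective coefficient 1. Fix targets σ for the objectives. Starting from L_0 = 0,
constraints turn lower bounds into upper bounds U_d, and objectives turn these into new lower bounds
L_{d+1}; L_d increases and U_d decreases with d. A solution meeting the targets lies between the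
bounds, so in the nondegenerate case the largest uniform target with L_R ≤ U_R at a given agent,
which depends only on a ball around it, is at least the optimum. Each agent takes as σ the minimum
of these values over a ball of radius 2R+1. Lower targets only loosen the bounds, so L_d ≤ U_d holds
at all active agents for all d ≤ R (`lower_localTarget_le_upper`).

The output averages U_d/Δ_I + (1 - 1/Δ_I) L_d over d < R. In a constraint w_u U_u = 1 - T + w_u L_u,
where T is the sum of the w_u L_u, so every layer is feasible. In an objective with n agents, Σσ ≤
ΣL_{d+1} + (n-1)ΣU_d. Summed over d, the index shift costs only ΣL_R ≤ Σσ, whence a factor 1 - 1/R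
(`le_sum_objPeers_averagedSolution`); a large R absorbs it into ε.

For locality, equal views of bounded depth in any two programs force equal outputs, so an algorithm
can gather its view and answer as in any program that realises it. -/

/-! ### Recursive bounds implied by targets -/

/-- The combinatorial core of a bipartite max-min linear program whose objectives have been
normalised to have unit coefficients: `act` is the set of agents taking part, and `w v` is the
coefficient of the agent `v` in its constraint `con v`. -/
structure AgentSystem (V I K : Type*) where
  con : V → I
  obj : V → K
  act : Finset V
  w : V → ℝ
  w_pos : ∀ v ∈ act, 0 < w v

namespace AgentSystem

variable {V I K : Type*} (S : AgentSystem V I K)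

open Classical in
/-- The active agents with the same constraint as `v`. -/
noncomputable def conPeers (v : V) : Finset V := S.act.filter fun u => S.con u = S.con v

open Classical in
/-- The active agents with the same objective as `v`. -/
noncomputable def objPeers (v : V) : Finset V := S.act.filter fun u => S.obj u = S.obj v

/-- The largest value that `v` can take if the other agents of its constraint take the values
given by `L`. -/
noncomputable def upperOf (L : V → ℝ) (v : V) : ℝ :=
  (1 - (∑ u ∈ S.conPeers v, S.w u * L u - S.w v * L v)) / S.w v

/-- The least nonnegative value that `v` has to take to lift its objective to `σ v` if the other
agents of its objective take the values given by `U`. -/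
noncomputable def lowerOf (σ U : V → ℝ) (v : V) : ℝ :=
  max 0 (σ v - (∑ u ∈ S.objPeers v, U u - U v))

/-- Lower bounds for the variables implied by the targets `σ` at depth `d`. -/
noncomputable def lower (σ : V → ℝ) : ℕ → V → ℝ
  | 0 => fun _ => 0
  | d + 1 => S.lowerOf σ (S.upperOf (lower σ d))

/-- Upper bounds for the variables implied by the targets `σ` at depth `d`. -/
noncomputable def upper (σ : V → ℝ) (d : ℕ) : V → ℝ := S.upperOf (S.lower σ d)

variable {S}

lemma mem_conPeers {u v : V} : u ∈ S.conPeers v ↔ u ∈ S.act ∧ S.con u = S.con v := by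
  simp [conPeers]

lemma mem_objPeers {u v : V} : u ∈ S.objPeers v ↔ u ∈ S.act ∧ S.obj u = S.obj v := by
  simp [objPeers]

lemma self_mem_conPeers {v : V} (hv : v ∈ S.act) : v ∈ S.conPeers v := mem_conPeers.2 ⟨hv, rfl⟩

lemma self_mem_objPeers {v : V} (hv : v ∈ S.act) : v ∈ S.objPeers v := mem_objPeers.2 ⟨hv, rfl⟩

lemma conPeers_congr {u v : V} (h : S.con u = S.con v) : S.conPeers u = S.conPeers v := by
  ext x
  simp [mem_conPeers, h]

lemma objPeers_congr {u v : V} (h : S.obj u = S.obj v) : S.objPeers u = S.objPeers v := by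
  ext x
  simp [mem_objPeers, h]

lemma sum_sub_self_le_sum_sub_self {s : Finset V} {v : V} (hv : v ∈ s) {f g : V → ℝ}
    (h : ∀ u ∈ s, f u ≤ g u) : ∑ u ∈ s, f u - f v ≤ ∑ u ∈ s, g u - g v := by
  classical
  rw [← Finset.sum_erase_eq_sub hv, ← Finset.sum_erase_eq_sub hv]
  exact Finset.sum_le_sum fun u hu => h u (Finset.mem_of_mem_erase hu)

lemma upperOf_anti {L L' : V → ℝ} {v : V} (hv : v ∈ S.act)
    (h : ∀ u ∈ S.conPeers v, L u ≤ L' u) : S.upperOf L' v ≤ S.upperOf L v := by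
  refine div_le_div_of_nonneg_right (sub_le_sub_left ?_ _) (S.w_pos v hv).le
  exact sum_sub_self_le_sum_sub_self (self_mem_conPeers hv) (f := fun u => S.w u * L u)
    (g := fun u => S.w u * L' u) fun u hu =>
    mul_le_mul_of_nonneg_left (h u hu) (S.w_pos u (mem_conPeers.1 hu).1).le

lemma lowerOf_mono {σ σ' U U' : V → ℝ} {v : V} (hv : v ∈ S.act) (hσ : σ v ≤ σ' v)
    (h : ∀ u ∈ S.objPeers v, U' u ≤ U u) : S.lowerOf σ U v ≤ S.lowerOf σ' U' v :=
  max_le_max le_rfl (sub_le_sub hσ (sum_sub_self_le_sum_sub_self (self_mem_objPeers hv) h))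

lemma lower_nonneg (σ : V → ℝ) (d : ℕ) (v : V) : 0 ≤ S.lower σ d v := by
  cases d with
  | zero => exact le_rfl
  | succ d => exact le_max_left _ _

lemma lower_le_succ (σ : V → ℝ) (d : ℕ) {v : V} (hv : v ∈ S.act) :
    S.lower σ d v ≤ S.lower σ (d + 1) v := by
  induction d generalizing v with
  | zero => exact lower_nonneg σ 1 v
  | succ d ih =>
    exact lowerOf_mono hv le_rfl fun u hu => upperOf_anti (mem_objPeers.1 hu).1 fun x hx =>
      ih (mem_conPeers.1 hx).1

lemma lower_mono (σ : V → ℝ) {v : V} (hv : v ∈ S.act) : Monotone fun d => S.lower σ d v :=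
  monotone_nat_of_le_succ fun d => lower_le_succ σ d hv

lemma upper_anti (σ : V → ℝ) {v : V} (hv : v ∈ S.act) : Antitone fun d => S.upper σ d v :=
  fun _ _ h => upperOf_anti hv fun _ hu => lower_mono σ (mem_conPeers.1 hu).1 h

lemma lower_le_upper_of_le {σ : V → ℝ} {v : V} (hv : v ∈ S.act) {R d : ℕ}
    (h : S.lower σ R v ≤ S.upper σ R v) (hd : d ≤ R) : S.lower σ d v ≤ S.upper σ d v :=
  ((lower_mono σ hv hd).trans h).trans (upper_anti σ hv hd)

/-- Every solution that meets the targets lies between the bounds. -/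
lemma lower_le_and_le_upper {σ y : V → ℝ} (hy : ∀ v ∈ S.act, 0 ≤ y v)
    (hcon : ∀ v ∈ S.act, ∑ u ∈ S.conPeers v, S.w u * y u ≤ 1)
    (hobj : ∀ v ∈ S.act, σ v ≤ ∑ u ∈ S.objPeers v, y u) (d : ℕ) :
    ∀ v ∈ S.act, S.lower σ d v ≤ y v ∧ y v ≤ S.upper σ d v := by
  -- The half-step from valid lower bounds to valid upper bounds serves both inside the induction
  -- and for the final upper bound.
  have key : ∀ L : V → ℝ, (∀ v ∈ S.act, L v ≤ y v) → ∀ v ∈ S.act, y v ≤ S.upperOf L v := by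
    intro L hL v hv
    refine le_trans ?_ (upperOf_anti hv fun u hu => hL u (mem_conPeers.1 hu).1)
    rw [upperOf, le_div_iff₀ (S.w_pos v hv)]
    linarith [hcon v hv, mul_comm (y v) (S.w v)]
  have low : ∀ v ∈ S.act, S.lower σ d v ≤ y v := by
    induction d with
    | zero => exact hy
    | succ d ih =>
      intro v hv
      refine (lowerOf_mono (U' := y) hv le_rfl fun u hu =>
        key _ ih u (mem_objPeers.1 hu).1).trans ?_
      exact max_le (hy v hv) (by linarith [hobj v hv])
  exact fun v hv => ⟨low v hv, key _ low v hv⟩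

/-! ### The largest consistent uniform target -/

lemma continuous_lower (d : ℕ) (v : V) :
    Continuous fun ω : ℝ => S.lower (fun _ => ω) d v := by
  induction d generalizing v with
  | zero => exact continuous_const
  | succ d ih =>
    simp only [lower, lowerOf, upperOf]
    fun_prop

lemma continuous_upper (d : ℕ) (v : V) :
    Continuous fun ω : ℝ => S.upper (fun _ => ω) d v := by
  have := continuous_lower (S := S) d
  simp only [upper, upperOf]
  fun_prop

variable (S) in
/-- The uniform targets that the bounds of depth `R` at the agent `v` do not rule out. -/
def targets (R : ℕ) (v : V) : Set ℝ :=
  {ω | 0 ≤ ω ∧ S.lower (fun _ => ω) R v ≤ S.upper (fun _ => ω) R v}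

variable (S) in
/-- The largest uniform target that the bounds of depth `R` at the agent `v` do not rule out. -/
noncomputable def maxTarget (R : ℕ) (v : V) : ℝ := sSup (S.targets R v)

lemma zero_mem_targets (R : ℕ) {v : V} (hv : v ∈ S.act) : 0 ∈ S.targets R v := by
  have := lower_le_and_le_upper (S := S) (σ := fun _ => 0) (y := fun _ => 0) (by simp) (by simp)
    (by simp) R v hv
  exact ⟨le_rfl, this.1.trans this.2⟩

/-- Targets enter the lower bounds only from depth 1 on; at `R = 0` every nonnegative target would
pass. -/
lemma bddAbove_targets {R : ℕ} (hR : R ≠ 0) {v : V} (hv : v ∈ S.act) :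
    BddAbove (S.targets R v) := by
  refine ⟨∑ u ∈ S.objPeers v, S.upperOf (fun _ => 0) u, fun ω hω => ?_⟩
  have h1 : S.lower (fun _ => ω) 1 v ≤ S.lower (fun _ => ω) R v :=
    lower_mono _ hv (Nat.one_le_iff_ne_zero.2 hR)
  have h2 : S.upper (fun _ => ω) R v ≤ S.upper (fun _ => ω) 0 v := upper_anti _ hv (Nat.zero_le R)
  have h3 : ω - (∑ u ∈ S.objPeers v, S.upperOf (fun _ => 0) u - S.upperOf (fun _ => 0) v) ≤
      S.lower (fun _ => ω) 1 v := le_max_right _ _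
  have h4 : S.upper (fun _ => ω) 0 v = S.upperOf (fun _ => 0) v := rfl
  linarith [hω.2]

/-- Continuity of the bounds in the target closes the set, so the supremum is itself a consistent
target. -/
lemma maxTarget_mem {R : ℕ} (hR : R ≠ 0) {v : V} (hv : v ∈ S.act) :
    S.maxTarget R v ∈ S.targets R v := by
  refine IsClosed.csSup_mem ?_ ⟨0, zero_mem_targets R hv⟩ (bddAbove_targets hR hv)
  exact isClosed_Ici.inter (isClosed_le (continuous_lower R v) (continuous_upper R v))

/-! ### Balls and targets chosen locally -/

variable (S) in
/-- The active agents that can be reached from `v` in `n` steps, each of them between two agents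
that share a constraint or an objective. -/
def reach : ℕ → V → Set V
  | 0, v => {v}
  | n + 1, v => {u | (∃ x ∈ S.conPeers v, u ∈ reach n x) ∨ ∃ x ∈ S.objPeers v, u ∈ reach n x}

lemma self_mem_reach (n : ℕ) {v : V} (hv : v ∈ S.act) : v ∈ S.reach n v := by
  induction n with
  | zero => rfl
  | succ n ih => exact Or.inl ⟨v, self_mem_conPeers hv, ih⟩

lemma mem_act_of_mem_reach {n : ℕ} {u v : V} (hv : v ∈ S.act) (h : u ∈ S.reach n v) :
    u ∈ S.act := by
  induction n generalizing v with
  | zero => rwa [Set.mem_singleton_iff.1 h]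
  | succ n ih =>
    obtain ⟨x, hx, h⟩ | ⟨x, hx, h⟩ := h
    · exact ih (mem_conPeers.1 hx).1 h
    · exact ih (mem_objPeers.1 hx).1 h

/-- `reach` adds steps at its centre; adding one at the far end is what reversing a path requires.
-/
lemma mem_reach_succ_of_peer {n : ℕ} {u u' v : V} (hu : u ∈ S.reach n v) (hu' : u' ∈ S.act)
    (h : S.con u = S.con u' ∨ S.obj u = S.obj u') : u' ∈ S.reach (n + 1) v := by
  induction n generalizing v with
  | zero =>
    obtain rfl := Set.mem_singleton_iff.1 hu
    obtain h | h := h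
    · exact Or.inl ⟨u', mem_conPeers.2 ⟨hu', h.symm⟩, rfl⟩
    · exact Or.inr ⟨u', mem_objPeers.2 ⟨hu', h.symm⟩, rfl⟩
  | succ n ih =>
    obtain ⟨x, hx, hu⟩ | ⟨x, hx, hu⟩ := hu
    · exact Or.inl ⟨x, hx, ih hu⟩
    · exact Or.inr ⟨x, hx, ih hu⟩

lemma reach_symm {n : ℕ} {u v : V} (hv : v ∈ S.act) (h : u ∈ S.reach n v) :
    v ∈ S.reach n u := by
  induction n generalizing v with
  | zero => exact (Set.mem_singleton_iff.1 h).symm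
  | succ n ih =>
    obtain ⟨x, hx, h⟩ | ⟨x, hx, h⟩ := h
    · have hx := mem_conPeers.1 hx
      exact mem_reach_succ_of_peer (ih hx.1 h) hv (Or.inl hx.2)
    · have hx := mem_objPeers.1 hx
      exact mem_reach_succ_of_peer (ih hx.1 h) hv (Or.inr hx.2)

lemma lower_le_of_le_on_reach {σ σ' : V → ℝ} (d : ℕ) {v : V} (hv : v ∈ S.act)
    (h : ∀ u ∈ S.reach (2 * d) v, σ u ≤ σ' u) : S.lower σ d v ≤ S.lower σ' d v := by
  induction d generalizing v with
  | zero => exact le_rfl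
  | succ d ih =>
    refine lowerOf_mono hv (h v (self_mem_reach _ hv)) fun u hu =>
      upperOf_anti (mem_objPeers.1 hu).1 fun x hx => ih (mem_conPeers.1 hx).1 fun z hz => ?_
    exact h z (Or.inr ⟨u, hu, Or.inl ⟨x, hx, hz⟩⟩)

lemma upper_le_of_le_on_reach {σ σ' : V → ℝ} (d : ℕ) {v : V} (hv : v ∈ S.act)
    (h : ∀ u ∈ S.reach (2 * d + 1) v, σ u ≤ σ' u) : S.upper σ' d v ≤ S.upper σ d v :=
  upperOf_anti hv fun x hx => lower_le_of_le_on_reach d (mem_conPeers.1 hx).1 fun z hz =>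
    h z (Or.inl ⟨x, hx, hz⟩)

variable (S) in
/-- The minimum of `maxTarget` over a ball. -/
noncomputable def localTarget (R : ℕ) (v : V) : ℝ :=
  sInf (S.maxTarget R '' S.reach (2 * R + 1) v)

lemma localTarget_le {R : ℕ} (hR : R ≠ 0) {u v : V} (hv : v ∈ S.act)
    (h : u ∈ S.reach (2 * R + 1) v) : S.localTarget R u ≤ S.maxTarget R v := by
  refine csInf_le ⟨0, ?_⟩ ⟨v, reach_symm hv h, rfl⟩
  rintro _ ⟨x, hx, rfl⟩
  exact (maxTarget_mem hR (mem_act_of_mem_reach (mem_act_of_mem_reach hv h) hx)).1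

lemma le_localTarget {R : ℕ} {ω : ℝ} (h : ∀ v ∈ S.act, ω ≤ S.maxTarget R v) {v : V}
    (hv : v ∈ S.act) : ω ≤ S.localTarget R v := by
  refine le_csInf ⟨_, v, self_mem_reach _ hv, rfl⟩ ?_
  rintro _ ⟨x, hx, rfl⟩
  exact h x (mem_act_of_mem_reach hv hx)

lemma localTarget_nonneg {R : ℕ} (hR : R ≠ 0) {v : V} (hv : v ∈ S.act) :
    0 ≤ S.localTarget R v :=
  le_localTarget (fun _ hu => (maxTarget_mem hR hu).1) hv

/-- The bounds of depth `R` at `v` see targets only within distance 2R+1, and every agent there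
included `maxTarget R v` in its minimum. By monotonicity they are no tighter than those of the
uniform target `maxTarget R v`, which are consistent. -/
lemma lower_localTarget_le_upper {R : ℕ} (hR : R ≠ 0) {v : V} (hv : v ∈ S.act) {d : ℕ}
    (hd : d ≤ R) : S.lower (S.localTarget R) d v ≤ S.upper (S.localTarget R) d v := by
  refine lower_le_upper_of_le hv ?_ hd
  have hU := upper_le_of_le_on_reach (σ := S.localTarget R) (σ' := fun _ => S.maxTarget R v) R hv
    fun u hu => localTarget_le hR hv hu
  have hL := lower_le_of_le_on_reach (σ := S.localTarget R) (σ' := fun _ => S.maxTarget R v) R hv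
    fun u hu => localTarget_le hR hv (mem_reach_succ_of_peer hu (mem_act_of_mem_reach hv hu)
      (Or.inl rfl))
  exact hL.trans ((maxTarget_mem hR hv).2.trans hU)

/-! ### Feasibility and value of the averaged solution -/

variable (S) in
/-- The convex combination, with weight `1 / Δ` on the upper bound, of the bounds, averaged over
the depths below `R`. -/
noncomputable def averagedSolution (Δ R : ℕ) (σ : V → ℝ) (v : V) : ℝ :=
  (∑ d ∈ Finset.range R, (S.upper σ d v / Δ + (1 - 1 / Δ) * S.lower σ d v)) / R

lemma one_sub_one_div_nonneg (Δ : ℕ) : (0 : ℝ) ≤ 1 - 1 / Δ := by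
  rcases Nat.eq_zero_or_pos Δ with rfl | h
  · simp
  · rw [sub_nonneg, div_le_one (by exact_mod_cast h)]
    exact_mod_cast h

lemma averagedSolution_nonneg {Δ R : ℕ} {σ : V → ℝ} {v : V}
    (h : ∀ d < R, S.lower σ d v ≤ S.upper σ d v) : 0 ≤ S.averagedSolution Δ R σ v := by
  refine div_nonneg (Finset.sum_nonneg fun d hd => ?_) (Nat.cast_nonneg R)
  have h0 := lower_nonneg (S := S) σ d v
  have h1 := h0.trans (h d (Finset.mem_range.1 hd))
  have := one_sub_one_div_nonneg Δ
  positivity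

/-- The slack 1 - T left by the lower bounds is common to the whole constraint, and each of at most
Δ agents takes a share (1 - T)/Δ of it. -/
lemma sum_conPeers_layer_le_one {Δ : ℕ} (hΔ : Δ ≠ 0) {σ : V → ℝ} {v : V} (hv : v ∈ S.act)
    (hcard : (S.conPeers v).card ≤ Δ) {d : ℕ} (h : S.lower σ d v ≤ S.upper σ d v) :
    ∑ u ∈ S.conPeers v, S.w u * (S.upper σ d u / Δ + (1 - 1 / Δ) * S.lower σ d u) ≤ 1 := by
  have hΔ' : (0 : ℝ) < Δ := by exact_mod_cast Nat.pos_of_ne_zero hΔ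
  set T := ∑ u ∈ S.conPeers v, S.w u * S.lower σ d u with hT
  have hU : ∀ u ∈ S.conPeers v, S.w u * S.upper σ d u = 1 - T + S.w u * S.lower σ d u := by
    intro u hu
    have hu := mem_conPeers.1 hu
    rw [upper, upperOf, conPeers_congr hu.2, ← hT, mul_div_cancel₀ _ (S.w_pos u hu.1).ne']
    ring
  -- Consistency at the single agent `v` already makes the common slack nonnegative.
  have hT1 : T ≤ 1 := by
    have := mul_le_mul_of_nonneg_left h (S.w_pos v hv).le
    rw [hU v (self_mem_conPeers hv)] at this
    linarith
  have : ∀ u ∈ S.conPeers v, S.w u * (S.upper σ d u / Δ + (1 - 1 / Δ) * S.lower σ d u) =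
      (1 - T) / Δ + S.w u * S.lower σ d u := by
    intro u hu
    have := hU u hu
    field_simp
    linear_combination this
  rw [Finset.sum_congr rfl this, Finset.sum_add_distrib, Finset.sum_const, nsmul_eq_mul, ← hT]
  have hn : ((S.conPeers v).card : ℝ) ≤ Δ := by exact_mod_cast hcard
  have : ((S.conPeers v).card : ℝ) * ((1 - T) / Δ) ≤ Δ * ((1 - T) / Δ) :=
    mul_le_mul_of_nonneg_right hn (div_nonneg (by linarith) hΔ'.le)
  rw [mul_div_cancel₀ _ hΔ'.ne'] at this
  linarith

lemma sum_conPeers_averagedSolution_le_one {Δ R : ℕ} (hΔ : Δ ≠ 0) {σ : V → ℝ} {v : V}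
    (hv : v ∈ S.act) (hcard : (S.conPeers v).card ≤ Δ)
    (h : ∀ d < R, S.lower σ d v ≤ S.upper σ d v) :
    ∑ u ∈ S.conPeers v, S.w u * S.averagedSolution Δ R σ u ≤ 1 := by
  simp only [averagedSolution, mul_div_assoc', ← Finset.sum_div, Finset.mul_sum]
  rw [Finset.sum_comm]
  refine div_le_one_of_le₀ ?_ (Nat.cast_nonneg R)
  refine (Finset.sum_le_sum fun d hd =>
    sum_conPeers_layer_le_one hΔ hv hcard (h d (Finset.mem_range.1 hd))).trans ?_
  simp

/-- The targets bound the objective from below when each agent in turn takes its lower bound and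
the other ones their upper bounds. -/
lemma sum_target_le_sum_bounds (σ : V → ℝ) (d : ℕ) (v : V) :
    ∑ u ∈ S.objPeers v, σ u ≤ ∑ u ∈ S.objPeers v, S.lower σ (d + 1) u +
      ((S.objPeers v).card - 1) * ∑ u ∈ S.objPeers v, S.upper σ d u := by
  have : ∀ u ∈ S.objPeers v, σ u ≤ S.lower σ (d + 1) u +
      (∑ x ∈ S.objPeers v, S.upper σ d x - S.upper σ d u) := by
    intro u hu
    have h : σ u - (∑ x ∈ S.objPeers u, S.upper σ d x - S.upper σ d u) ≤
      S.lower σ (d + 1) u := le_max_right _ _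
    rw [objPeers_congr (mem_objPeers.1 hu).2] at h
    linarith
  refine (Finset.sum_le_sum this).trans (le_of_eq ?_)
  rw [Finset.sum_add_distrib, Finset.sum_sub_distrib, Finset.sum_const, nsmul_eq_mul]
  ring

lemma lower_succ_le_target {σ : V → ℝ} {d : ℕ} {v : V} (hv : v ∈ S.act) (hσ : 0 ≤ σ v)
    (h : ∀ u ∈ S.objPeers v, 0 ≤ S.upper σ d u) : S.lower σ (d + 1) v ≤ σ v := by
  refine max_le hσ ?_
  have := sum_sub_self_le_sum_sub_self (self_mem_objPeers hv) (f := fun _ => (0 : ℝ)) h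
  simp only [Finset.sum_const_zero, sub_zero] at this
  have h' : S.upperOf (S.lower σ d) = S.upper σ d := rfl
  rw [h']
  linarith

lemma le_sum_objPeers_averagedSolution {ΔI ΔK R : ℕ} (hI : 2 ≤ ΔI) (hK : 2 ≤ ΔK) (hR : R ≠ 0)
    {σ : V → ℝ} {v : V} (hv : v ∈ S.act) (hcard : (S.objPeers v).card ≤ ΔK)
    (h : ∀ u ∈ S.act, ∀ d < R, S.lower σ d u ≤ S.upper σ d u) (hσ : ∀ u ∈ S.act, 0 ≤ σ u) {ω : ℝ}
    (hω : ∀ u ∈ S.act, ω ≤ σ u) :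
    ω * (1 - 1 / R) ≤
      ΔI * (1 - 1 / ΔK) * ∑ u ∈ S.objPeers v, S.averagedSolution ΔI R σ u := by
  set s := S.objPeers v with hs
  have hact : ∀ u ∈ s, u ∈ S.act := fun u hu => (mem_objPeers.1 hu).1
  have hn1 : (1 : ℝ) ≤ s.card := by
    exact_mod_cast Finset.card_pos.2 ⟨v, self_mem_objPeers hv⟩
  have hnK : (s.card : ℝ) ≤ ΔK := by exact_mod_cast hcard
  have hI' : (2 : ℝ) ≤ ΔI := by exact_mod_cast hI
  have hK' : (2 : ℝ) ≤ ΔK := by exact_mod_cast hK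
  have hR1 : (1 : ℝ) ≤ R := by exact_mod_cast Nat.one_le_iff_ne_zero.2 hR
  set n : ℝ := (s.card : ℝ)
  set A := ∑ d ∈ Finset.range R, ∑ u ∈ s, S.lower σ d u with hA
  set B := ∑ d ∈ Finset.range R, ∑ u ∈ s, S.upper σ d u with hB
  set T := ∑ u ∈ s, σ u with hT
  have hA0 : 0 ≤ A := Finset.sum_nonneg fun d _ => Finset.sum_nonneg fun u _ => lower_nonneg σ d u
  have hAB : A ≤ B := Finset.sum_le_sum fun d hd => Finset.sum_le_sum fun u hu =>
    h u (hact u hu) d (Finset.mem_range.1 hd)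
  have hlast : ∑ u ∈ s, S.lower σ R u ≤ T := by
    obtain ⟨r, rfl⟩ := Nat.exists_eq_succ_of_ne_zero hR
    refine Finset.sum_le_sum fun u hu => lower_succ_le_target (hact u hu) (hσ u (hact u hu))
      fun x hx => ?_
    exact (lower_nonneg σ r x).trans (h x (mem_objPeers.1 hx).1 r (Nat.lt_succ_self r))
  -- Since L_0 = 0, shifting the depth by one only adds the layer at depth `R`.
  have hshift : ∑ d ∈ Finset.range R, ∑ u ∈ s, S.lower σ (d + 1) u =
      A + ∑ u ∈ s, S.lower σ R u := by
    have h1 := Finset.sum_range_succ (fun d => ∑ u ∈ s, S.lower σ d u) R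
    have h2 := Finset.sum_range_succ' (fun d => ∑ u ∈ s, S.lower σ d u) R
    have h3 : ∑ u ∈ s, S.lower σ 0 u = 0 := by simp [lower]
    rw [h3, add_zero] at h2
    rw [← h2, h1]
  have hsum : R * T ≤ A + T + (n - 1) * B := by
    have := Finset.sum_le_sum fun d (_ : d ∈ Finset.range R) =>
      sum_target_le_sum_bounds (S := S) σ d v
    rw [Finset.sum_const, Finset.card_range, nsmul_eq_mul, Finset.sum_add_distrib,
      ← Finset.mul_sum, hshift] at this
    linarith
  have hωT : n * ω ≤ T := by
    have := Finset.card_nsmul_le_sum s σ ω fun u hu => hω u (hact u hu)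
    rwa [nsmul_eq_mul] at this
  have hval : ∑ u ∈ s, S.averagedSolution ΔI R σ u = (B / ΔI + (1 - 1 / ΔI) * A) / R := by
    simp only [averagedSolution]
    rw [← Finset.sum_div, Finset.sum_comm]
    simp only [Finset.sum_add_distrib, ← Finset.mul_sum, ← Finset.sum_div]
    rw [hA, hB]
  rw [hval]
  have h1 : n * ω * (R - 1) ≤ A + (n - 1) * B := by
    have := mul_le_mul_of_nonneg_right hωT (sub_nonneg.2 hR1)
    linarith
  -- The mean (A + (n-1)B)/n grows with n because A ≤ B, so n may be replaced by `ΔK`; the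
  -- difference of the two sides is (ΔK - n)(B - A).
  have h2 : ΔK * (A + (n - 1) * B) ≤ n * (A + (ΔK - 1) * B) := by
    nlinarith [mul_nonneg (sub_nonneg.2 hnK) (sub_nonneg.2 hAB)]
  have h3 : ΔK * (ω * (R - 1)) ≤ A + (ΔK - 1) * B := by
    have : n * (ΔK * (ω * (R - 1))) ≤ n * (A + (ΔK - 1) * B) := by
      refine le_trans ?_ h2
      have := mul_le_mul_of_nonneg_left h1 (by linarith : (0 : ℝ) ≤ ΔK)
      linarith
    exact le_of_mul_le_mul_left this (by linarith)
  -- Here both degree bounds being at least 2 matters: (ΔK - 1)(ΔI - 1) ≥ 1.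
  have h4 : A ≤ (ΔK - 1) * ((ΔI - 1) * A) := by
    nlinarith [mul_nonneg (mul_nonneg (sub_nonneg.2 hK') (sub_nonneg.2 hI')) hA0,
      mul_nonneg (sub_nonneg.2 hK') hA0, mul_nonneg (sub_nonneg.2 hI') hA0]
  have h5 : ΔK * (ω * (R - 1)) ≤ (ΔK - 1) * (B + (ΔI - 1) * A) := by linarith
  have hK0 : (0 : ℝ) < ΔK := by linarith
  have hI0 : (0 : ℝ) < ΔI := by linarith
  have hR0 : (0 : ℝ) < R := by linarith
  have e1 : ω * (1 - 1 / R) = ΔK * (ω * (R - 1)) / (ΔK * R) := by field_simp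
  have e2 : ΔI * (1 - 1 / ΔK) * ((B / ΔI + (1 - 1 / ΔI) * A) / R) =
      (ΔK - 1) * (B + (ΔI - 1) * A) / (ΔK * R) := by field_simp
  rw [e1, e2]
  exact div_le_div_of_nonneg_right h5 (by positivity)

end AgentSystem

-- Views and local quantities

universe u₁ u₂ u₃

set_option linter.checkUnivs false in
/-- A bipartite max-min linear program with a port numbering of its graph. -/
structure PortedLP where
  V : Type u₁
  I : Type u₂
  K : Type u₃
  [fintypeV : Fintype V]
  lp : MaxMinLP V I K
  bipartite : lp.IsBipartite
  numbering : lp.PortNumbering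

attribute [instance] PortedLP.fintypeV

/-- What a node can learn in a fixed number of rounds: its own input and what its neighbours had
learnt one round earlier, in the order of the ports. -/
inductive View where
  | node (input : LocalInput) (children : List View)

namespace View

def input : View → LocalInput
  | node i _ => i

def children : View → List View
  | node _ l => l

end View

namespace PortedLP

/-- The constraint of an agent. -/
noncomputable def con (X : PortedLP) (v : X.V) : X.I := (X.bipartite v).1.choose

/-- The objective of an agent. -/
noncomputable def obj (X : PortedLP) (v : X.V) : X.K := (X.bipartite v).2.choose

lemma adj_constr_iff {X : PortedLP} {v : X.V} {i : X.I} :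
    X.lp.graph.Adj (.agent v) (.constr i) ↔ X.con v = i := by
  have h := (X.bipartite v).1.choose_spec
  exact ⟨fun hi => (h.2 i hi).symm, fun hi => hi ▸ h.1⟩

lemma adj_obj_iff {X : PortedLP} {v : X.V} {k : X.K} :
    X.lp.graph.Adj (.agent v) (.obj k) ↔ X.obj v = k := by
  have h := (X.bipartite v).2.choose_spec
  exact ⟨fun hi => (h.2 k hi).symm, fun hi => hi ▸ h.1⟩

/-- The coefficient of an agent in its constraint. -/
noncomputable def conCoeff (X : PortedLP) (v : X.V) : ℝ := X.lp.a (X.con v) v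

/-- The coefficient of an agent in its objective. -/
noncomputable def objCoeff (X : PortedLP) (v : X.V) : ℝ := X.lp.c (X.obj v) v

open Classical in
/-- The normalised system formed by the agents both of whose coefficients are positive. -/
noncomputable def system (X : PortedLP) : AgentSystem X.V X.I X.K where
  con := X.con
  obj := X.obj
  act := Finset.univ.filter fun v => 0 < X.conCoeff v ∧ 0 < X.objCoeff v
  w := fun v => X.conCoeff v / X.objCoeff v
  w_pos := fun v hv => by
    have h := (Finset.mem_filter.1 hv).2
    exact div_pos h.1 h.2

lemma mem_act {X : PortedLP} {v : X.V} :
    v ∈ X.system.act ↔ 0 < X.conCoeff v ∧ 0 < X.objCoeff v := by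
  simp [system]

/-- The view of a node after `r` rounds. -/
def view (X : PortedLP) : ℕ → Node X.V X.I X.K → View
  | 0, s => .node (PortAlgorithm.localInput X.numbering s) []
  | r + 1, s => .node (PortAlgorithm.localInput X.numbering s)
      ((X.numbering.ports s).map (view X r))

lemma input_view (X : PortedLP) (r : ℕ) (s : Node X.V X.I X.K) :
    (X.view r s).input = PortAlgorithm.localInput X.numbering s := by
  cases r <;> rfl

/-- Transfers data between ports of two different graphs whose lists of views agree: `p` and `p'`
are the views, `q` and `q'` the data they determine. -/
lemma filterMap_eq_of_map_eq {α β γ δ : Type*} {p : α → γ} {p' : β → γ} {q : α → Option δ}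
    {q' : β → Option δ} (h : ∀ x y, p x = p' y → q x = q' y) {l : List α} {l' : List β}
    (hl : l.map p = l'.map p') : l.filterMap q = l'.filterMap q' := by
  induction l generalizing l' with
  | nil => cases l' with
    | nil => rfl
    | cons => simp at hl
  | cons x l ih => cases l' with
    | nil => simp at hl
    | cons y l' =>
      simp only [List.map_cons, List.cons.injEq] at hl
      simp only [List.filterMap_cons, h x y hl.1, ih hl.2]

lemma map_view_eq {X Y : PortedLP} {r : ℕ} {s : Node X.V X.I X.K} {t : Node Y.V Y.I Y.K}
    (h : X.view (r + 1) s = Y.view (r + 1) t) :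
    (X.numbering.ports s).map (X.view r) = (Y.numbering.ports t).map (Y.view r) :=
  congrArg View.children h

lemma view_eq_of_view_succ_eq {X Y : PortedLP} {r : ℕ} {s : Node X.V X.I X.K}
    {t : Node Y.V Y.I Y.K} (h : X.view (r + 1) s = Y.view (r + 1) t) :
    X.view r s = Y.view r t := by
  have hin := congrArg View.input h
  rw [input_view, input_view] at hin
  induction r generalizing s t with
  | zero => rw [view, view, hin]
  | succ r ih =>
    have := filterMap_eq_of_map_eq (q := fun x => some (X.view r x))
      (q' := fun y => some (Y.view r y)) (fun x y hxy => congrArg some (ih hxy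
        (by simpa only [input_view] using congrArg View.input hxy))) (map_view_eq h)
    rw [view, view, hin]
    simpa using this

lemma view_eq_of_le {X Y : PortedLP} {m n : ℕ} (hmn : m ≤ n) {s : Node X.V X.I X.K}
    {t : Node Y.V Y.I Y.K} (h : X.view n s = Y.view n t) : X.view m s = Y.view m t := by
  induction n, hmn using Nat.le_induction with
  | base => exact h
  | succ n _ ih => exact ih (view_eq_of_view_succ_eq h)

/-- The quantity `f` attached to the agents is determined by their views after `r` rounds. -/
def IsLocalAt {α : Type*} (r : ℕ) (f : (X : PortedLP) → X.V → α) : Prop :=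
  ∀ ⦃X Y : PortedLP⦄ ⦃v : X.V⦄ ⦃u : Y.V⦄,
    X.view r (.agent v) = Y.view r (.agent u) → f X v = f Y u

/-- The quantity `f` attached to the agents can be computed in a bounded number of rounds. -/
def IsLocal {α : Type*} (f : (X : PortedLP) → X.V → α) : Prop := ∃ r, IsLocalAt r f

section Closure

variable {α β γ : Type*} {f : (X : PortedLP) → X.V → α} {g : (X : PortedLP) → X.V → β}

lemma IsLocalAt.mono {m n : ℕ} (h : IsLocalAt m f) (hmn : m ≤ n) : IsLocalAt n f :=
  fun _ _ _ _ hv => h (view_eq_of_le hmn hv)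

lemma isLocal_const (x : α) : IsLocal fun _ _ => x := ⟨0, fun _ _ _ _ _ => rfl⟩

lemma IsLocal.comp (h : IsLocal f) (φ : α → β) : IsLocal fun X v => φ (f X v) := by
  obtain ⟨r, h⟩ := h
  exact ⟨r, fun _ _ _ _ hv => congrArg φ (h hv)⟩

lemma IsLocal.comp₂ (hf : IsLocal f) (hg : IsLocal g) (φ : α → β → γ) :
    IsLocal fun X v => φ (f X v) (g X v) := by
  obtain ⟨m, hf⟩ := hf
  obtain ⟨n, hg⟩ := hg
  exact ⟨max m n, fun _ _ _ _ hv => congrArg₂ φ (hf.mono (le_max_left m n) hv)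
    (hg.mono (le_max_right m n) hv)⟩

end Closure

/-- The list of the coefficients on the edges of an agent. -/
def edgeList (X : PortedLP) (v : X.V) : List (ℝ ⊕ ℝ) :=
  (X.numbering.ports (.agent v)).filterMap fun t =>
    match t with
    | .agent _ => none
    | .constr i => some (.inl (X.lp.a i v))
    | .obj k => some (.inr (X.lp.c k v))

lemma localInput_agent (X : PortedLP) (v : X.V) :
    PortAlgorithm.localInput X.numbering (.agent v) = .agent (X.edgeList v) := by
  rw [PortAlgorithm.localInput, edgeList]
  congr 2
  funext t
  cases t <;> rfl

lemma edgeList_eq {X Y : PortedLP} {v : X.V} {v' : Y.V}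
    (h : X.view 0 (.agent v) = Y.view 0 (.agent v')) : X.edgeList v = Y.edgeList v' := by
  have h := congrArg View.input h
  rw [input_view, input_view, localInput_agent, localInput_agent] at h
  exact LocalInput.agent.inj h

lemma inl_mem_edgeList {X : PortedLP} {v : X.V} {x : ℝ} :
    .inl x ∈ X.edgeList v ↔ x = X.conCoeff v := by
  rw [edgeList, List.mem_filterMap]
  constructor
  · rintro ⟨t, ht, h⟩
    rw [X.numbering.mem_ports] at ht
    cases t with
    | agent u => simp at h
    | constr i =>
      obtain rfl := adj_constr_iff.1 ht
      simpa [conCoeff] using h.symm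
    | obj k => simp at h
  · rintro rfl
    exact ⟨.constr (X.con v), (X.numbering.mem_ports _ _).2 (adj_constr_iff.2 rfl), rfl⟩

lemma inr_mem_edgeList {X : PortedLP} {v : X.V} {x : ℝ} :
    .inr x ∈ X.edgeList v ↔ x = X.objCoeff v := by
  rw [edgeList, List.mem_filterMap]
  constructor
  · rintro ⟨t, ht, h⟩
    rw [X.numbering.mem_ports] at ht
    cases t with
    | agent u => simp at h
    | constr i => simp at h
    | obj k =>
      obtain rfl := adj_obj_iff.1 ht
      simpa [objCoeff] using h.symm
  · rintro rfl
    exact ⟨.obj (X.obj v), (X.numbering.mem_ports _ _).2 (adj_obj_iff.2 rfl), rfl⟩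

lemma isLocalAt_conCoeff : IsLocalAt 0 conCoeff := fun X Y v v' h => by
  rw [← inl_mem_edgeList, ← edgeList_eq h, inl_mem_edgeList]

lemma isLocalAt_objCoeff : IsLocalAt 0 objCoeff := fun X Y v v' h => by
  rw [← inr_mem_edgeList, ← edgeList_eq h, inr_mem_edgeList]

lemma isLocalAt_mem_act : IsLocalAt 0 fun X v => v ∈ X.system.act := fun X Y v v' h => by
  simp only [mem_act, isLocalAt_conCoeff h, isLocalAt_objCoeff h]

lemma isLocal_w : IsLocal fun X v => X.system.w v :=
  IsLocal.comp₂ ⟨0, isLocalAt_conCoeff⟩ ⟨0, isLocalAt_objCoeff⟩ fun x y => x / y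

/-- The constraint is the only neighbour of an agent whose input is of constraint type, so it can be
picked out of the children. -/
lemma view_constr_con_eq {X Y : PortedLP} {r : ℕ} {v : X.V} {v' : Y.V}
    (h : X.view (r + 1) (.agent v) = Y.view (r + 1) (.agent v')) :
    X.view r (.constr (X.con v)) = Y.view r (.constr (Y.con v')) := by
  have hmem : X.view r (.constr (X.con v)) ∈
      (Y.numbering.ports (.agent v')).map (Y.view r) := by
    rw [← map_view_eq h]
    exact List.mem_map_of_mem ((X.numbering.mem_ports _ _).2 (adj_constr_iff.2 rfl))
  obtain ⟨t, ht, hview⟩ := List.mem_map.1 hmem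
  have hin := congrArg View.input hview
  rw [input_view, input_view] at hin
  rw [Y.numbering.mem_ports] at ht
  cases t with
  | agent u => cases hin
  | constr i => rw [← hview, adj_constr_iff.1 ht]
  | obj k => cases hin

lemma view_obj_obj_eq {X Y : PortedLP} {r : ℕ} {v : X.V} {v' : Y.V}
    (h : X.view (r + 1) (.agent v) = Y.view (r + 1) (.agent v')) :
    X.view r (.obj (X.obj v)) = Y.view r (.obj (Y.obj v')) := by
  have hmem : X.view r (.obj (X.obj v)) ∈
      (Y.numbering.ports (.agent v')).map (Y.view r) := by
    rw [← map_view_eq h]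
    exact List.mem_map_of_mem ((X.numbering.mem_ports _ _).2 (adj_obj_iff.2 rfl))
  obtain ⟨t, ht, hview⟩ := List.mem_map.1 hmem
  have hin := congrArg View.input hview
  rw [input_view, input_view] at hin
  rw [Y.numbering.mem_ports] at ht
  cases t with
  | agent u => cases hin
  | constr i => cases hin
  | obj k => rw [← hview, adj_obj_iff.1 ht]

/-! ### Collecting values from peers -/

open Classical in
/-- A node as an active agent, if it is one. -/
noncomputable def activeAgent (X : PortedLP) : Node X.V X.I X.K → Option X.V
  | .agent v => if v ∈ X.system.act then some v else none
  | .constr _ => none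
  | .obj _ => none

/-- The active agents adjacent to a node, in the order of the ports. -/
noncomputable def activeNbrs (X : PortedLP) (s : Node X.V X.I X.K) : List X.V :=
  (X.numbering.ports s).filterMap X.activeAgent

lemma activeAgent_eq_some {X : PortedLP} {s : Node X.V X.I X.K} {v : X.V} :
    X.activeAgent s = some v ↔ s = .agent v ∧ v ∈ X.system.act := by
  cases s with
  | agent u =>
    simp only [activeAgent, Node.agent.injEq]
    split_ifs with h
    · simp only [Option.some.injEq]
      exact ⟨fun e => ⟨e, e ▸ h⟩, fun e => e.1⟩
    · simp only [false_iff]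
      rintro ⟨rfl, h'⟩
      exact h h'
  | constr i => simp [activeAgent]
  | obj k => simp [activeAgent]

lemma mem_activeNbrs {X : PortedLP} {s : Node X.V X.I X.K} {v : X.V} :
    v ∈ X.activeNbrs s ↔ X.lp.graph.Adj (.agent v) s ∧ v ∈ X.system.act := by
  simp only [activeNbrs, List.mem_filterMap, activeAgent_eq_some, X.numbering.mem_ports]
  constructor
  · rintro ⟨_, h, rfl, hv⟩
    exact ⟨h.symm, hv⟩
  · rintro ⟨h, hv⟩
    exact ⟨_, h.symm, rfl, hv⟩

lemma nodup_activeNbrs (X : PortedLP) (s : Node X.V X.I X.K) : (X.activeNbrs s).Nodup := by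
  refine List.Nodup.filterMap (fun t t' v h h' => ?_) (X.numbering.nodup s)
  rw [(activeAgent_eq_some.1 h).1, (activeAgent_eq_some.1 h').1]

lemma conPeers_val (X : PortedLP) (v : X.V) :
    (X.system.conPeers v).val = X.activeNbrs (.constr (X.con v)) := by
  refine (Multiset.Nodup.ext (Finset.nodup _) (Multiset.coe_nodup.2 (nodup_activeNbrs X _))).2
    fun u => ?_
  rw [Finset.mem_val, Multiset.mem_coe, AgentSystem.mem_conPeers, mem_activeNbrs, adj_constr_iff,
    and_comm]
  rfl

lemma objPeers_val (X : PortedLP) (v : X.V) :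
    (X.system.objPeers v).val = X.activeNbrs (.obj (X.obj v)) := by
  refine (Multiset.Nodup.ext (Finset.nodup _) (Multiset.coe_nodup.2 (nodup_activeNbrs X _))).2
    fun u => ?_
  rw [Finset.mem_val, Multiset.mem_coe, AgentSystem.mem_objPeers, mem_activeNbrs, adj_obj_iff,
    and_comm]
  rfl

lemma map_activeNbrs_eq {α : Type*} {f : (X : PortedLP) → X.V → α} {r : ℕ} (hf : IsLocalAt r f)
    {X Y : PortedLP} {s : Node X.V X.I X.K} {t : Node Y.V Y.I Y.K}
    (h : X.view (r + 1) s = Y.view (r + 1) t) :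
    (X.activeNbrs s).map (f X) = (Y.activeNbrs t).map (f Y) := by
  simp only [activeNbrs, List.map_filterMap]
  refine filterMap_eq_of_map_eq (fun x y hxy => ?_) (map_view_eq h)
  have hin := congrArg View.input hxy
  rw [input_view, input_view] at hin
  cases x with
  | agent u =>
    cases y with
    | agent u' =>
      have hact : (u ∈ X.system.act) = (u' ∈ Y.system.act) :=
        isLocalAt_mem_act.mono (Nat.zero_le r) hxy
      by_cases hu : u' ∈ Y.system.act
      · simp [activeAgent, hact, hu, hf hxy]
      · simp [activeAgent, hact, hu]
    | constr i => cases hin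
    | obj k => cases hin
  | constr i =>
    cases y with
    | agent u' => cases hin
    | constr i => rfl
    | obj k => rfl
  | obj k =>
    cases y with
    | agent u' => cases hin
    | constr i => rfl
    | obj k => rfl

section Peers

variable {α : Type*} {f : (X : PortedLP) → X.V → α}

lemma IsLocal.conPeers (h : IsLocal f) :
    IsLocal fun X v => (X.system.conPeers v).val.map (f X) := by
  obtain ⟨r, h⟩ := h
  refine ⟨r + 2, fun X Y v v' hv => ?_⟩
  simp only [conPeers_val, Multiset.map_coe, map_activeNbrs_eq h (view_constr_con_eq hv)]

lemma IsLocal.objPeers (h : IsLocal f) :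
    IsLocal fun X v => (X.system.objPeers v).val.map (f X) := by
  obtain ⟨r, h⟩ := h
  refine ⟨r + 2, fun X Y v v' hv => ?_⟩
  simp only [objPeers_val, Multiset.map_coe, map_activeNbrs_eq h (view_obj_obj_eq hv)]

end Peers

/-! ### Locality of the computed solution -/

section Bounds

variable {Ω : Type*} {σ : (X : PortedLP) → Ω → X.V → ℝ}

/-- Because `upperOf` is a full sum minus the agent's own term, the multiset of peer values
suffices: an anonymous agent need not recognise itself among its peers. The parameter in `Ω` makes
whole functions of the target local, so that a supremum over targets can be taken afterwards. -/
lemma isLocal_upperOf {L : (X : PortedLP) → Ω → X.V → ℝ} (h : IsLocal fun X v ω => L X ω v) :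
    IsLocal fun X v ω => X.system.upperOf (L X ω) v := by
  have h1 := isLocal_w.comp₂ h Prod.mk
  have h2 := h1.comp₂ h1.conPeers fun p m ω =>
    (1 - ((m.map fun q => q.1 * q.2 ω).sum - p.1 * p.2 ω)) / p.1
  simp only [Multiset.map_map] at h2
  exact h2

lemma isLocal_lowerOf {U : (X : PortedLP) → Ω → X.V → ℝ} (hσ : IsLocal fun X v ω => σ X ω v)
    (h : IsLocal fun X v ω => U X ω v) :
    IsLocal fun X v ω => X.system.lowerOf (σ X ω) (U X ω) v := by
  have h2 := (hσ.comp₂ h Prod.mk).comp₂ h.objPeers fun p m ω =>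
    max 0 (p.1 ω - ((m.map fun q => q ω).sum - p.2 ω))
  simp only [Multiset.map_map] at h2
  exact h2

lemma isLocal_lower (hσ : IsLocal fun X v ω => σ X ω v) (d : ℕ) :
    IsLocal fun X v ω => X.system.lower (σ X ω) d v := by
  induction d with
  | zero => exact isLocal_const (fun _ => (0 : ℝ))
  | succ d ih => exact isLocal_lowerOf hσ (isLocal_upperOf ih)

lemma isLocal_upper (hσ : IsLocal fun X v ω => σ X ω v) (d : ℕ) :
    IsLocal fun X v ω => X.system.upper (σ X ω) d v :=
  isLocal_upperOf (isLocal_lower hσ d)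

end Bounds

lemma isLocal_maxTarget (R : ℕ) : IsLocal fun X v => X.system.maxTarget R v := by
  have hσ : IsLocal fun (X : PortedLP) (_ : X.V) (ω : ℝ) => ω := isLocal_const _
  exact (isLocal_lower (σ := fun _ ω _ => ω) hσ R).comp₂ (isLocal_upper (σ := fun _ ω _ => ω) hσ R)
    fun l u => sSup {ω : ℝ | 0 ≤ ω ∧ l ω ≤ u ω}

/-- Without identifiers the ball itself is not computable, but the set of values on it is, and a
minimum needs no more. -/
lemma isLocal_image_reach {α : Type*} {f : (X : PortedLP) → X.V → α} (h : IsLocal f) (n : ℕ) :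
    IsLocal fun X v => f X '' X.system.reach n v := by
  induction n with
  | zero => simpa only [AgentSystem.reach, Set.image_singleton] using h.comp fun x => ({x} : Set α)
  | succ n ih =>
    have := ih.conPeers.comp₂ ih.objPeers fun m m' => {x | (∃ s ∈ m, x ∈ s) ∨ ∃ s ∈ m', x ∈ s}
    convert this using 3 with X v
    ext x
    simp only [AgentSystem.reach, Set.mem_image, Set.mem_ofPred_eq, Multiset.mem_map,
      Finset.mem_val]
    constructor
    · rintro ⟨u, ⟨y, hy, hu⟩ | ⟨y, hy, hu⟩, rfl⟩
      · exact Or.inl ⟨_, ⟨y, hy, rfl⟩, u, hu, rfl⟩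
      · exact Or.inr ⟨_, ⟨y, hy, rfl⟩, u, hu, rfl⟩
    · rintro (⟨_, ⟨y, hy, rfl⟩, u, hu, rfl⟩ | ⟨_, ⟨y, hy, rfl⟩, u, hu, rfl⟩)
      · exact ⟨u, Or.inl ⟨y, hy, hu⟩, rfl⟩
      · exact ⟨u, Or.inr ⟨y, hy, hu⟩, rfl⟩

lemma isLocal_localTarget (R : ℕ) : IsLocal fun X v => X.system.localTarget R v :=
  (isLocal_image_reach (isLocal_maxTarget R) (2 * R + 1)).comp sInf

lemma isLocal_averagedSolution {σ : (X : PortedLP) → X.V → ℝ} (hσ : IsLocal σ) (Δ R : ℕ) :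
    IsLocal fun X v => X.system.averagedSolution Δ R (σ X) v := by
  have hσ' : IsLocal fun X v (_ : Unit) => σ X v := hσ.comp fun x _ => x
  have hsum : ∀ n : ℕ, IsLocal fun X v => ∑ d ∈ Finset.range n,
      (X.system.upper (σ X) d v / Δ + (1 - 1 / Δ) * X.system.lower (σ X) d v) := by
    intro n
    induction n with
    | zero => simpa using isLocal_const (0 : ℝ)
    | succ n ih =>
      simp only [Finset.sum_range_succ]
      refine ih.comp₂ (IsLocal.comp₂ ((isLocal_upper (σ := fun X _ => σ X) hσ' n).comp fun g => g ())
        ((isLocal_lower (σ := fun X _ => σ X) hσ' n).comp fun g => g ())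
        fun x y => x / Δ + (1 - 1 / Δ) * y) (· + ·)
  exact (hsum R).comp fun x => x / R

open Classical in
/-- The solution computed by the local algorithm. -/
noncomputable def solution (X : PortedLP) (Δ R : ℕ) (v : X.V) : ℝ :=
  if v ∈ X.system.act then
    X.system.averagedSolution Δ R (X.system.localTarget R) v / X.objCoeff v
  else 0

lemma isLocal_solution (Δ R : ℕ) : IsLocal fun X v => X.solution Δ R v := by
  classical
  have h := (isLocal_averagedSolution (isLocal_localTarget R) Δ R).comp₂
    (IsLocal.comp₂ ⟨0, isLocalAt_objCoeff⟩ ⟨0, isLocalAt_mem_act⟩ Prod.mk)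
    fun x p => if p.2 then x / p.1 else 0
  convert h using 3 with X v
  rw [solution]
  congr

/-! ### From local quantities to algorithms -/

/-- The algorithm in which every node gathers its view for `r` rounds. -/
def gatherAlgorithm (r : ℕ) (out : View → ℝ) : PortAlgorithm where
  State := View
  Msg := View
  horizon := r
  init := fun i => .node i []
  send := fun s _ => s
  step := fun s l => .node s.input l
  output := out

lemma state_gatherAlgorithm (X : PortedLP) (r : ℕ) (out : View → ℝ) (n : ℕ)
    (s : Node X.V X.I X.K) :
    (gatherAlgorithm r out).state X.numbering n s = X.view n s := by
  induction n generalizing s with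
  | zero => rfl
  | succ n ih =>
    rw [PortAlgorithm.state, view, ← input_view X n s, ← ih s]
    exact congrArg (View.node _) (List.map_congr_left fun t _ => ih t)

/-- The output rule chooses any program and agent realising the gathered view; locality makes the
choice irrelevant. -/
theorem IsLocal.exists_portAlgorithm {f : (X : PortedLP) → X.V → ℝ} (h : IsLocal f) :
    ∃ A : PortAlgorithm, ∀ X : PortedLP, A.run X.numbering = f X := by
  classical
  obtain ⟨r, h⟩ := h
  refine ⟨gatherAlgorithm r fun t =>
    if ht : ∃ (X : PortedLP) (v : X.V), X.view r (.agent v) = t then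
      f ht.choose ht.choose_spec.choose else 0, fun X => funext fun v => ?_⟩
  have ht : ∃ (Y : PortedLP) (v' : Y.V), Y.view r (.agent v') = X.view r (.agent v) :=
    ⟨X, v, rfl⟩
  rw [PortAlgorithm.run, state_gatherAlgorithm]
  exact (dif_pos ht).trans (h ht.choose_spec.choose_spec)

end PortedLP

/-! ### Return to the original linear program -/

namespace PortedLP

variable {X : PortedLP}

lemma mem_constrAgents {i : X.I} {v : X.V} : v ∈ X.lp.constrAgents i ↔ X.con v = i := by
  simp [MaxMinLP.constrAgents, adj_constr_iff]

lemma mem_objAgents {k : X.K} {v : X.V} : v ∈ X.lp.objAgents k ↔ X.obj v = k := by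
  simp [MaxMinLP.objAgents, adj_obj_iff]

lemma conPeers_subset (v : X.V) : X.system.conPeers v ⊆ X.lp.constrAgents (X.con v) :=
  fun _ hu => mem_constrAgents.2 (AgentSystem.mem_conPeers.1 hu).2

lemma objPeers_subset (v : X.V) : X.system.objPeers v ⊆ X.lp.objAgents (X.obj v) :=
  fun _ hu => mem_objAgents.2 (AgentSystem.mem_objPeers.1 hu).2

lemma conCoeff_nonneg (v : X.V) : 0 ≤ X.conCoeff v :=
  X.lp.a_nonneg _ _ (adj_constr_iff.2 rfl)

lemma objCoeff_nonneg (v : X.V) : 0 ≤ X.objCoeff v :=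
  X.lp.c_nonneg _ _ (adj_obj_iff.2 rfl)

lemma objCoeff_eq_zero (hX : X.lp.NonDegenerate) {v : X.V} (hv : v ∉ X.system.act) :
    X.objCoeff v = 0 := by
  by_contra hne
  have hc := lt_of_le_of_ne (objCoeff_nonneg v) (Ne.symm hne)
  exact hv (mem_act.2 ⟨hX v _ _ (adj_constr_iff.2 rfl) (adj_obj_iff.2 rfl) hc, hc⟩)

lemma sum_constrAgents {i : X.I} {x : X.V → ℝ} :
    ∑ v ∈ X.lp.constrAgents i, X.lp.a i v * x v =
      ∑ v ∈ X.lp.constrAgents i, X.conCoeff v * x v :=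
  Finset.sum_congr rfl fun v hv => by rw [conCoeff, mem_constrAgents.1 hv]

lemma objective_eq {k : X.K} {x : X.V → ℝ} :
    X.lp.objective k x = ∑ v ∈ X.lp.objAgents k, X.objCoeff v * x v :=
  Finset.sum_congr rfl fun v hv => by rw [objCoeff, mem_objAgents.1 hv]

/-- A vector supported on the active agents has in a constraint the value of the normalised
system. -/
lemma sum_constrAgents_eq_sum_conPeers {v : X.V} {x : X.V → ℝ}
    (hx : ∀ u ∉ X.system.act, X.conCoeff u * x u = 0) :
    ∑ u ∈ X.lp.constrAgents (X.con v), X.lp.a (X.con v) u * x u =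
      ∑ u ∈ X.system.conPeers v, X.system.w u * (X.objCoeff u * x u) := by
  rw [sum_constrAgents, ← Finset.sum_subset (conPeers_subset v) fun u hu hu' => hx u fun hact =>
    hu' (AgentSystem.mem_conPeers.2 ⟨hact, mem_constrAgents.1 hu⟩)]
  refine Finset.sum_congr rfl fun u hu => ?_
  have hc := (mem_act.1 (AgentSystem.mem_conPeers.1 hu).1).2
  change _ = X.conCoeff u / X.objCoeff u * (X.objCoeff u * x u)
  field_simp

lemma objective_eq_sum_objPeers {v : X.V} {x : X.V → ℝ}
    (hx : ∀ u ∉ X.system.act, X.objCoeff u * x u = 0) :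
    X.lp.objective (X.obj v) x = ∑ u ∈ X.system.objPeers v, X.objCoeff u * x u := by
  rw [objective_eq, ← Finset.sum_subset (objPeers_subset v) fun u hu hu' => hx u fun hact =>
    hu' (AgentSystem.mem_objPeers.2 ⟨hact, mem_objAgents.1 hu⟩)]

lemma objCoeff_mul_solution {Δ R : ℕ} {v : X.V} (hv : v ∈ X.system.act) :
    X.objCoeff v * X.solution Δ R v =
      X.system.averagedSolution Δ R (X.system.localTarget R) v := by
  rw [solution, if_pos hv, mul_div_cancel₀ _ (mem_act.1 hv).2.ne']

lemma solution_of_notMem {Δ R : ℕ} {v : X.V} (hv : v ∉ X.system.act) : X.solution Δ R v = 0 := by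
  rw [solution, if_neg hv]

lemma solution_nonneg {Δ R : ℕ} (hR : R ≠ 0) (v : X.V) : 0 ≤ X.solution Δ R v := by
  by_cases hv : v ∈ X.system.act
  · rw [solution, if_pos hv]
    exact div_nonneg (AgentSystem.averagedSolution_nonneg fun d hd =>
      AgentSystem.lower_localTarget_le_upper hR hv hd.le) (objCoeff_nonneg v)
  · exact (solution_of_notMem hv).ge

theorem isFeasible_solution {ΔI ΔK R : ℕ} (hI : ΔI ≠ 0) (hR : R ≠ 0)
    (hdeg : X.lp.DegreeBounded ΔI ΔK) : X.lp.IsFeasible (X.solution ΔI R) := by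
  refine ⟨fun i => ?_, solution_nonneg hR⟩
  by_cases hi : ∃ v ∈ X.system.act, X.con v = i
  · obtain ⟨v, hv, rfl⟩ := hi
    rw [sum_constrAgents_eq_sum_conPeers fun u hu => by rw [solution_of_notMem hu, mul_zero],
      Finset.sum_congr rfl fun u hu => by
        rw [objCoeff_mul_solution (AgentSystem.mem_conPeers.1 hu).1]]
    exact AgentSystem.sum_conPeers_averagedSolution_le_one hI hv
      ((Finset.card_le_card (conPeers_subset v)).trans (hdeg.1 _))
      fun d hd => AgentSystem.lower_localTarget_le_upper hR hv hd.le
  · rw [Finset.sum_eq_zero fun v hv => ?_]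
    · exact zero_le_one
    · rw [solution_of_notMem fun hact => hi ⟨v, hact, mem_constrAgents.1 hv⟩, mul_zero]

lemma utility_le [Finite X.K] (x : X.V → ℝ) (k : X.K) : X.lp.utility x ≤ X.lp.objective k x :=
  ciInf_le (Set.finite_range _).bddBelow k

lemma utility_nonneg {x : X.V → ℝ} (hx : X.lp.IsFeasible x) : 0 ≤ X.lp.utility x :=
  Real.iInf_nonneg fun _ => objective_eq.symm ▸ Finset.sum_nonneg fun v _ =>
    mul_nonneg (objCoeff_nonneg v) (hx.2 v)

lemma opt_le {ω : ℝ} (h : ∀ x, X.lp.IsFeasible x → X.lp.utility x ≤ ω) : X.lp.opt ≤ ω := by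
  refine csSup_le ⟨_, fun _ => 0, ⟨fun i => ?_, fun v => le_rfl⟩, rfl⟩ ?_
  · simp
  · rintro _ ⟨x, hx, rfl⟩
    exact h x hx

lemma opt_nonneg : 0 ≤ X.lp.opt := by
  refine Real.sSup_nonneg ?_
  rintro _ ⟨x, hx, rfl⟩
  exact utility_nonneg hx

/-- The utility of any feasible `x` is a consistent target, witnessed by the rescaled vector c_v
x_v. Dropping inactive agents only relaxes the constraints and, by nondegeneracy, leaves the
objectives unchanged. -/
lemma opt_le_maxTarget [Finite X.K] (hX : X.lp.NonDegenerate) {R : ℕ} (hR : R ≠ 0) {v : X.V}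
    (hv : v ∈ X.system.act) : X.lp.opt ≤ X.system.maxTarget R v := by
  refine opt_le fun x hx => le_csSup (AgentSystem.bddAbove_targets hR hv) ⟨utility_nonneg hx, ?_⟩
  have h := AgentSystem.lower_le_and_le_upper (S := X.system) (σ := fun _ => X.lp.utility x)
    (y := fun u => X.objCoeff u * x u) (fun u _ => mul_nonneg (objCoeff_nonneg u) (hx.2 u))
    (fun u _ => ?_) (fun u _ => ?_) R v hv
  · exact h.1.trans h.2
  · refine le_trans (le_of_eq_of_le ?_ (Finset.sum_le_sum_of_subset_of_nonneg
      (f := fun z => X.conCoeff z * x z) (conPeers_subset u)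
      fun z _ _ => mul_nonneg (conCoeff_nonneg z) (hx.2 z))) (sum_constrAgents ▸ hx.1 (X.con u))
    refine Finset.sum_congr rfl fun z hz => ?_
    have hc := (mem_act.1 (AgentSystem.mem_conPeers.1 hz).1).2
    change X.conCoeff z / X.objCoeff z * (X.objCoeff z * x z) = _
    field_simp
  · rw [← objective_eq_sum_objPeers fun z hz => by rw [objCoeff_eq_zero hX hz, zero_mul]]
    exact utility_le x _

theorem opt_mul_le_objective_solution [Finite X.K] (hX : X.lp.NonDegenerate) {ΔI ΔK R : ℕ}
    (hI : 2 ≤ ΔI) (hK : 2 ≤ ΔK) (hR : R ≠ 0) (hdeg : X.lp.DegreeBounded ΔI ΔK) (k : X.K) :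
    X.lp.opt * (1 - 1 / R) ≤
      ΔI * (1 - 1 / ΔK) * X.lp.objective k (X.solution ΔI R) := by
  by_cases hk : ∃ v ∈ X.system.act, X.obj v = k
  · obtain ⟨v, hv, rfl⟩ := hk
    rw [objective_eq_sum_objPeers fun u hu => by rw [solution_of_notMem hu, mul_zero],
      Finset.sum_congr rfl fun u hu =>
        objCoeff_mul_solution (AgentSystem.mem_objPeers.1 hu).1]
    exact AgentSystem.le_sum_objPeers_averagedSolution hI hK hR hv
      ((Finset.card_le_card (objPeers_subset v)).trans (hdeg.2 _))
      (fun u hu d hd => AgentSystem.lower_localTarget_le_upper hR hu hd.le)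
      (fun u hu => AgentSystem.localTarget_nonneg hR hu)
      fun u hu => AgentSystem.le_localTarget (fun z hz => opt_le_maxTarget hX hR hz) hu
  -- An objective without active agents vanishes identically, which forces the optimum to be 0.
  · have hzero : ∀ x : X.V → ℝ, X.lp.objective k x = 0 := fun x => by
      rw [objective_eq]
      refine Finset.sum_eq_zero fun v hv => ?_
      rw [objCoeff_eq_zero hX fun hact => hk ⟨v, hact, mem_objAgents.1 hv⟩, zero_mul]
    have : X.lp.opt = 0 :=
      le_antisymm (opt_le fun x _ => (utility_le x k).trans (hzero x).le) opt_nonneg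
    rw [this, hzero, zero_mul, mul_zero]

end PortedLP

/-! ### The main theorem -/

theorem theorem1 (ΔI ΔK : ℕ) (hI : 2 ≤ ΔI) (hK : 2 ≤ ΔK) (ε : ℝ) (hε : 0 < ε) :
    ∃ A : PortAlgorithm,
      ∀ (V I K : Type*) [Fintype V] [Fintype I] [Fintype K] (P : MaxMinLP V I K),
        P.IsBipartite → P.DegreeBounded ΔI ΔK → ∀ N : P.PortNumbering,
          P.IsFeasible (A.run N) ∧
          (P.NonDegenerate → ∀ k : K,
            P.opt / ((ΔI : ℝ) * (1 - 1 / (ΔK : ℝ)) + ε) ≤ P.objective k (A.run N)) := by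
  set ρ : ℝ := (ΔI : ℝ) * (1 - 1 / (ΔK : ℝ)) with hρ
  have hρ0 : 0 ≤ ρ := mul_nonneg (Nat.cast_nonneg _) (AgentSystem.one_sub_one_div_nonneg ΔK)
  -- This is the size of `R` for which ρ/(1 - 1/R) ≤ ρ + ε.
  obtain ⟨R, hRlt⟩ := exists_nat_gt ((ρ + ε) / ε)
  have hR0 : (0 : ℝ) < R := lt_of_le_of_lt (by positivity) hRlt
  have hR : R ≠ 0 := by exact_mod_cast hR0.ne'
  have hRε : ρ ≤ (ρ + ε) * (1 - 1 / R) := by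
    rw [div_lt_iff₀ hε] at hRlt
    have : (ρ + ε) / R ≤ ε := by
      rw [div_le_iff₀ hR0]
      linarith
    have e : (ρ + ε) * (1 - 1 / R) = ρ + ε - (ρ + ε) / R := by ring
    linarith
  obtain ⟨A, hA⟩ := (PortedLP.isLocal_solution ΔI R).exists_portAlgorithm
  refine ⟨A, fun V I K _ _ _ P hP hdeg N => ?_⟩
  let X : PortedLP := ⟨V, I, K, P, hP, N⟩
  have hrun : A.run N = X.solution ΔI R := hA X
  rw [hrun]
  refine ⟨PortedLP.isFeasible_solution (X := X) (by omega) hR hdeg, fun hdegen k => ?_⟩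
  have : Finite X.K := inferInstanceAs (Finite K)
  have h := PortedLP.opt_mul_le_objective_solution (X := X) hdegen hI hK hR hdeg k
  have hobj : 0 ≤ P.objective k (X.solution ΔI R) := by
    change 0 ≤ X.lp.objective k _
    rw [PortedLP.objective_eq]
    exact Finset.sum_nonneg fun v _ =>
      mul_nonneg (PortedLP.objCoeff_nonneg v) (PortedLP.solution_nonneg hR v)
  change P.opt * _ ≤ ρ * P.objective k _ at h
  rw [div_le_iff₀ (by positivity)]
  have hρpos : 0 < 1 - 1 / (R : ℝ) := by
    by_contra hle
    have hρ1 : 0 < ρ := by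
      have : (2 : ℝ) ≤ ΔK := by exact_mod_cast hK
      have h2 : 1 / (ΔK : ℝ) ≤ 1 / 2 := one_div_le_one_div_of_le (by norm_num) this
      have h3 : (2 : ℝ) ≤ ΔI := by exact_mod_cast hI
      exact mul_pos (by linarith) (by linarith)
    nlinarith
  refine le_of_mul_le_mul_right (h.trans ?_) hρpos
  calc ρ * P.objective k (X.solution ΔI R)
      ≤ (ρ + ε) * (1 - 1 / R) * P.objective k (X.solution ΔI R) :=
        mul_le_mul_of_nonneg_right hRε hobj
    _ = P.objective k (X.solution ΔI R) * (ρ + ε) * (1 - 1 / R) := by ring
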